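/- Let $0<r_e<r_a<r_s$ and $\lambda,\mu\ge 0$. The Earth is the ball of radius $r_e$ centred at the origin. Satellites form an isotropic Cox point process $\Psi$ on the sphere of radius $r_s$: the orbits, with longitude $\theta$ and inclination $\phi$, are great circles $l(\theta,\phi)$ of that sphere whose parameters form a Poisson point process on $[0,\pi)\times[0,\pi)$ with density $\lambda\sin(\phi)/(2\pi)$; conditionally on the orbits, the satellites on the different orbits form independent Poisson point processes, of intensity $\mu/(2\pi r_s)$ per unit length on each orbit. The typical gateway is at $U=(0,0,r_e)$, and its aerial platform $A$ is at height $r_a-r_e$ above the horizontal plane through $U$, seen from $U$ at a random zenith angle $Z\in[0,\pi/2)$ and an arbitrary (possibly random) azimuth, where zenith angle and azimuth are jointly independent of $\Psi$. Put $$r_l=\sqrt{r_a^2+(r_a-r_e)^2\tan^2 Z},\qquad \hat\varphi=\arccos(r_e/r_l)+\arccos(r_e/r_s),$$ and assume that $\hat\varphi\le\pi/2$ almost surely. Then the connectivity probability, that is, the probability that at least one satellite is visible from the platform (the segment from $A$ to the satellite does not enter the interior of the Earth), equals $$1-\mathbb E_Z\left[\exp\left(-\lambda\int_0^{\hat\varphi}\cos(\varphi)\left(1-e^{-\frac{\mu}{\pi}\arcsin\sqrt{1-\cos^2(\hat\varphi)\sec^2(\varphi)}}\right)d\varphi\right)\right].$$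 -/

import Mathlib

open MeasureTheory ProbabilityTheory Set

noncomputable section

/-- Physical space with the Euclidean norm; the centre of the Earth is the origin. -/
abbrev Space3 : Type := EuclideanSpace ℝ (Fin 3)

/-! ### Orbits -/

/-- The point with argument angle `w` on the circular orbit of radius `rs` around the origin with
longitude `θ` and inclination `φ`: the vector `rs (cos w, sin w, 0)` is first rotated by `φ` about
the `x`-axis and then by `θ` about the `z`-axis. -/
def orbitPoint (rs θ φ w : ℝ) : Space3 :=
  !₂[rs * (Real.cos w * Real.cos θ - Real.sin w * Real.cos φ * Real.sin θ),
     rs * (Real.cos w * Real.sin θ + Real.sin w * Real.cos φ * Real.cos θ),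
     rs * (Real.sin w * Real.sin φ)]

/-- Arc length on the orbit with longitude `θ` and inclination `φ` (the orbit is parametrized
by its argument angle with constant speed `rs`). -/
def orbitLength (rs θ φ : ℝ) : Measure Space3 :=
  Measure.map (orbitPoint rs θ φ)
    (ENNReal.ofReal rs • (volume : Measure ℝ).restrict (Ico 0 (2 * Real.pi)))

/-- The measure `lam * sin φ / (2π) dθ dφ` on the rectangle `[0, π) × [0, π)` of pairs `(θ, φ)`. -/
def orbitIntensity (lam : ℝ) : Measure (ℝ × ℝ) :=
  ((volume : Measure (ℝ × ℝ)).restrict (Ico 0 Real.pi ×ˢ Ico 0 Real.pi)).withDensity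
    (fun p => ENNReal.ofReal (lam * Real.sin p.2 / (2 * Real.pi)))

/-! ### Poisson point processes -/

/-- The random measure `N` is a Poisson point process with intensity measure `Λ`: the number of
points in a measurable set `B` has the Poisson law of mean `Λ B`, and the numbers of points in
pairwise disjoint measurable sets are independent. -/
structure IsPoissonPP {Ω X : Type*} [MeasurableSpace Ω] [MeasurableSpace X]
    (P : Measure Ω) (N : Ω → Measure X) (Λ : Measure X) : Prop where
  measurable : Measurable N
  count_law : ∀ B : Set X, MeasurableSet B → Λ B ≠ ⊤ → ∀ k : ℕ,
    P {ω | N ω B = (k : ENNReal)} = poissonMeasure (Λ B).toNNReal {k}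
  count_top : ∀ B : Set X, MeasurableSet B → Λ B = ⊤ → ∀ᵐ ω ∂P, N ω B = ⊤
  indep : ∀ (n : ℕ) (B : Fin n → Set X), (∀ j, MeasurableSet (B j)) →
    Pairwise (fun j j' => Disjoint (B j) (B j')) → iIndepFun (fun j ω => N ω (B j)) P

/-! ### Satellites -/

/-- Finitely many random orbits, with finitely many random satellites on each of them. The
parameters with index `i ≥ numOrbits ω` or `j ≥ numSat i ω` play no role. -/
structure SatelliteNetwork (Ω : Type*) [MeasurableSpace Ω] where
  /-- the number of orbits -/
  numOrbits : Ω → ℕ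
  /-- the pair (longitude, inclination) of the `i`-th orbit -/
  orbit : ℕ → Ω → ℝ × ℝ
  /-- the number of satellites on the `i`-th orbit -/
  numSat : ℕ → Ω → ℕ
  /-- the argument angle of the `j`-th satellite on the `i`-th orbit -/
  arg : ℕ → ℕ → Ω → ℝ
  measurable_numOrbits : Measurable numOrbits
  measurable_orbit : ∀ i, Measurable (orbit i)
  measurable_numSat : ∀ i, Measurable (numSat i)
  measurable_arg : ∀ i j, Measurable (arg i j)

namespace SatelliteNetwork

variable {Ω : Type*} [MeasurableSpace Ω] (S : SatelliteNetwork Ω)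

/-- The orbit process on the rectangle: the sum of the unit masses at the orbit parameters. -/
def orbitPoints (ω : Ω) : Measure (ℝ × ℝ) :=
  ∑ i ∈ Finset.range (S.numOrbits ω), Measure.dirac (S.orbit i ω)

/-- The `j`-th satellite on the `i`-th orbit. -/
def satellite (rs : ℝ) (i j : ℕ) (ω : Ω) : Space3 :=
  orbitPoint rs (S.orbit i ω).1 (S.orbit i ω).2 (S.arg i j ω)

/-- The satellite point process on the `i`-th orbit. -/
def satOnOrbit (rs : ℝ) (i : ℕ) (ω : Ω) : Measure Space3 :=
  ∑ j ∈ Finset.range (S.numSat i ω), Measure.dirac (S.satellite rs i j ω)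

/-- The satellite point process. -/
def satPoints (rs : ℝ) (ω : Ω) : Measure Space3 :=
  ∑ i ∈ Finset.range (S.numOrbits ω), S.satOnOrbit rs i ω

/-- The σ-algebra generated by the orbits. -/
@[reducible]
def orbitSigma : MeasurableSpace Ω :=
  MeasurableSpace.comap (fun ω => (S.numOrbits ω, fun i => S.orbit i ω)) inferInstance

/-- The intensity measure of the satellites on the `i`-th orbit: density `mu / (2π rs)` with respect
to arc length. -/
def satIntensity (mu rs : ℝ) (i : ℕ) (ω : Ω) : Measure Space3 :=
  ENNReal.ofReal (mu / (2 * Real.pi * rs)) • orbitLength rs (S.orbit i ω).1 (S.orbit i ω).2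

/-- The isotropic satellite Cox point process: the orbit process is Poisson with density
`lam * sin φ / (2π)` on `[0, π) × [0, π)` and, conditionally on the orbits, the satellites on the
different orbits are independent Poisson point processes, with density `mu / (2π rs)` along each
orbit. The second condition is stated through the joint conditional law of the
numbers of satellites on finitely many existing orbits in finitely many disjoint sets. -/
structure IsCox (P : Measure Ω) (lam mu rs : ℝ) : Prop where
  orbits : IsPoissonPP P S.orbitPoints (orbitIntensity lam)
  satellites : ∀ (I : Finset ℕ) (n : ℕ) (B : Fin n → Set Space3) (k : ℕ → Fin n → ℕ),
    (∀ j, MeasurableSet (B j)) → Pairwise (fun j j' => Disjoint (B j) (B j')) →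
    ∀ᵐ ω ∂P, (∀ i ∈ I, i < S.numOrbits ω) →
      (P⟦{ω' | ∀ i ∈ I, ∀ j, S.satOnOrbit rs i ω' (B j) = (k i j : ENNReal)} | S.orbitSigma⟧) ω
        = ∏ i ∈ I, ∏ j,
            (poissonMeasure (S.satIntensity mu rs i ω (B j)).toNNReal).real {k i j}

end SatelliteNetwork

/-! ### The aerial platform and its visible cap -/

/-- The typical gateway, at the north pole of the Earth of radius `re`. -/
def gateway (re : ℝ) : Space3 := !₂[0, 0, re]

/-- The aerial platform serving the gateway, at height `ra - re` above the horizontal plane through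
the gateway, seen from the gateway at zenith angle `z` (that is, elevation angle `π / 2 - z`) and
azimuth `α`. -/
def platform (re ra z α : ℝ) : Space3 :=
  gateway re + !₂[(ra - re) * Real.tan z * Real.cos α, (ra - re) * Real.tan z * Real.sin α, ra - re]

/-- The extended spherical cap: the points of the sphere of radius `rs` that are visible from `a`,
that is, whose line of sight to `a` does not enter the interior of the Earth. -/
def visibleCap (re rs : ℝ) (a : Space3) : Set Space3 :=
  {x | x ∈ Metric.sphere (0 : Space3) rs ∧ Disjoint (segment ℝ a x) (Metric.ball (0 : Space3) re)}

/-- The event that at least one satellite lies in the cap visible from the platform. -/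
def connectivityEvent {Ω : Type*} [MeasurableSpace Ω] (S : SatelliteNetwork Ω) (re ra rs : ℝ)
    (Z α : Ω → ℝ) : Set Ω :=
  {ω | ∃ i < S.numOrbits ω, ∃ j < S.numSat i ω,
    S.satellite rs i j ω ∈ visibleCap re rs (platform re ra (Z ω) (α ω))}

/-- The distance `r_l` of the platform from the centre of the Earth. -/
def platformRadius (re ra z : ℝ) : ℝ :=
  Real.sqrt (ra ^ 2 + (ra - re) ^ 2 * Real.tan z ^ 2)

/-- The angle `φ̂ = arccos (r_e / r_l) + arccos (r_e / r_s)`. -/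
def capAngle (re ra rs z : ℝ) : ℝ :=
  Real.arccos (re / platformRadius re ra z) + Real.arccos (re / rs)

/-- The probability, as a function of `φ̂`, that there is no satellite in the cap:
`exp (-λ ∫_0^φ̂ cos φ (1 - exp (-(μ/π) arcsin √(1 - cos² φ̂ sec² φ))) dφ)`. -/
def voidFormula (lam mu φhat : ℝ) : ℝ :=
  Real.exp (-lam * ∫ φ in (0 : ℝ)..φhat, Real.cos φ *
    (1 - Real.exp (-(mu / Real.pi) *
      Real.arcsin (Real.sqrt (1 - Real.cos φhat ^ 2 * (1 / Real.cos φ) ^ 2)))))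

end

/-! ### Lines of sight -/

/-! Fix the platform. The points of the satellite sphere that it sees form a spherical cap about its
direction, of angular radius the sum of two central angles, each between a point and a point of
tangency to the Earth (`visibleCap_platform_eq_sphericalCap`).

Given the orbits, a set `C` contains no satellite with probability the product of `exp (-q)` over
the orbits, `q` being the mean number of satellites of the orbit in `C`. The Laplace functional of
the Poisson orbit process averages this to `exp (-∫ (1 - exp (-q)))`
(`IsPoissonPP.integral_exp_neg_integral`, `IsCox.void_probability`).

For a cap with unit axis `a`, `q` depends on the orbit only through the squared inner product of `a`
with the orbit normal (`meanCount_sphericalCap`). The density `sin φ` makes the normals uniform up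
to sign, so `a` may be moved to the north pole (`lintegral_orbitIntensity`), which leaves a
one-dimensional integral. Independence and Tonelli then average over the position of the platform
(`proposition1`). -/

theorem disjoint_segment_ball_iff {E : Type*} [NormedAddCommGroup E] [InnerProductSpace ℝ E]
    {a x : E} {r p q : ℝ} (hr : 0 < r) (hp : 0 < p) (hq : 0 < q)
    (ha : ‖a‖ ^ 2 = r ^ 2 + p ^ 2) (hx : ‖x‖ ^ 2 = r ^ 2 + q ^ 2) :
    Disjoint (segment ℝ a x) (Metric.ball 0 r) ↔ r ^ 2 - p * q ≤ inner ℝ a x := by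
  -- `p` and `q` are the tangent lengths from `a` and `x`. The excess over `r ^ 2` is a square plus
  -- a nonnegative multiple of the quantity whose sign is in question; the weights with `s * p = t *
  -- q` kill the square.
  have key : ∀ s t : ℝ, s + t = 1 → ‖s • a + t • x‖ ^ 2
      = r ^ 2 + (s * p - t * q) ^ 2 + 2 * s * t * (inner ℝ a x - (r ^ 2 - p * q)) := by
    intro s t hst
    rw [norm_add_sq_real, norm_smul, norm_smul, mul_pow, mul_pow, ha, hx, inner_smul_left,
      inner_smul_right, Real.norm_eq_abs, Real.norm_eq_abs, sq_abs, sq_abs]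
    obtain rfl : s = 1 - t := by linarith
    simp only [conj_trivial]
    ring
  rw [Set.disjoint_left]
  constructor
  · intro h
    by_contra! hlt
    have hpq : 0 < p + q := by positivity
    have hst : q / (p + q) + p / (p + q) = 1 := by field_simp; ring
    have hmem : (q / (p + q)) • a + (p / (p + q)) • x ∈ segment ℝ a x :=
      ⟨_, _, by positivity, by positivity, hst, rfl⟩
    refine h hmem ?_
    rw [mem_ball_zero_iff]
    refine lt_of_pow_lt_pow_left₀ 2 hr.le ?_
    rw [key _ _ hst]
    have h0 : q / (p + q) * p - p / (p + q) * q = 0 := by ring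
    have hpos : 0 < 2 * (q / (p + q)) * (p / (p + q)) := by positivity
    rw [h0]
    nlinarith
  · rintro h _ ⟨s, t, hs, ht, hst, rfl⟩ hb
    rw [mem_ball_zero_iff] at hb
    have h1 : ‖s • a + t • x‖ ^ 2 < r ^ 2 := by gcongr
    rw [key _ _ hst] at h1
    have : 0 ≤ 2 * s * t * (inner ℝ a x - (r ^ 2 - p * q)) :=
      mul_nonneg (by positivity) (by linarith)
    nlinarith [sq_nonneg (s * p - t * q)]

theorem norm_platform (re ra z α : ℝ) : ‖platform re ra z α‖ = platformRadius re ra z := by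
  rw [EuclideanSpace.norm_eq, platformRadius]
  congr 1
  simp [platform, gateway, Fin.sum_univ_three]
  linear_combination (ra - re) ^ 2 * Real.tan z ^ 2 * Real.cos_sq_add_sin_sq α

theorem lt_platformRadius {re ra : ℝ} (hre : 0 < re) (hra : re < ra) (z : ℝ) :
    re < platformRadius re ra z := by
  refine Real.lt_sqrt_of_sq_lt ?_
  nlinarith [mul_nonneg (sq_nonneg (ra - re)) (sq_nonneg (Real.tan z))]

/-- Turns the tangency threshold of `disjoint_segment_ball_iff` into the cosine of the central
angle: each `arccos` is the angle between a point and its point of tangency. -/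
theorem mul_cos_arccos_add_arccos {r R R' : ℝ} (hr : 0 < r) (hR : r < R) (hR' : r < R') :
    R * R' * Real.cos (Real.arccos (r / R) + Real.arccos (r / R'))
      = r ^ 2 - √(R ^ 2 - r ^ 2) * √(R' ^ 2 - r ^ 2) := by
  have key : ∀ S : ℝ, r < S → S * √(1 - (r / S) ^ 2) = √(S ^ 2 - r ^ 2) := by
    intro S hS
    have hS0 : 0 < S := hr.trans hS
    rw [← Real.sqrt_sq hS0.le, ← Real.sqrt_mul (sq_nonneg S), Real.sqrt_sq hS0.le]
    congr 1
    field_simp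
  have hlt : ∀ S : ℝ, r < S → -1 ≤ r / S ∧ r / S ≤ 1 := by
    intro S hS
    have hS0 : 0 < S := hr.trans hS
    have : 0 < r / S := by positivity
    exact ⟨by linarith, (div_le_one hS0).2 hS.le⟩
  rw [Real.cos_add, Real.cos_arccos (hlt R hR).1 (hlt R hR).2,
    Real.cos_arccos (hlt R' hR').1 (hlt R' hR').2, Real.sin_arccos, Real.sin_arccos,
    ← key R hR, ← key R' hR']
  have : R ≠ 0 := (hr.trans hR).ne'
  have : R' ≠ 0 := (hr.trans hR').ne'
  field_simp

theorem visibleCap_platform {re ra rs : ℝ} (hre : 0 < re) (hra : re < ra) (hrs : ra < rs)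
    (z α : ℝ) :
    visibleCap re rs (platform re ra z α) = {x | ‖x‖ = rs ∧
      platformRadius re ra z * rs * Real.cos (capAngle re ra rs z)
        ≤ inner ℝ (platform re ra z α) x} := by
  have hR := lt_platformRadius hre hra z
  have hs : re < rs := hra.trans hrs
  ext x
  simp only [visibleCap, mem_ofPred_eq, mem_sphere_zero_iff_norm]
  refine and_congr_right fun hx => ?_
  have h1 : 0 < platformRadius re ra z ^ 2 - re ^ 2 := by nlinarith
  have h2 : 0 < rs ^ 2 - re ^ 2 := by nlinarith
  rw [capAngle, mul_cos_arccos_add_arccos hre hR hs]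
  refine disjoint_segment_ball_iff hre (Real.sqrt_pos.2 h1) (Real.sqrt_pos.2 h2) ?_ ?_
  · rw [norm_platform, Real.sq_sqrt h1.le]; ring
  · rw [hx, Real.sq_sqrt h2.le]; ring

theorem norm_orbitPoint {rs : ℝ} (hrs : 0 ≤ rs) (θ φ w : ℝ) : ‖orbitPoint rs θ φ w‖ = rs := by
  rw [EuclideanSpace.norm_eq, Real.sqrt_eq_iff_eq_sq (by positivity) hrs]
  simp [orbitPoint, Fin.sum_univ_three]
  have h1 := Real.sin_sq_add_cos_sq θ
  have h2 := Real.sin_sq_add_cos_sq φ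
  have h3 := Real.sin_sq_add_cos_sq w
  linear_combination rs ^ 2 * (Real.cos w ^ 2 + Real.sin w ^ 2 * Real.cos φ ^ 2) * h1
    + rs ^ 2 * Real.sin w ^ 2 * h2 + rs ^ 2 * h3

/-! ### Arcs -/

/-- The unit normal of the plane of the orbit with longitude `θ` and inclination `φ`. -/
noncomputable def orbitNormal (θ φ : ℝ) : Space3 :=
  !₂[Real.sin φ * Real.sin θ, -(Real.sin φ * Real.cos θ), Real.cos φ]

theorem inner_orbitPoint (a : Space3) (rs θ φ w : ℝ) :
    inner ℝ a (orbitPoint rs θ φ w) = rs * ((a 0 * Real.cos θ + a 1 * Real.sin θ) * Real.cos w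
      + (-(a 0 * Real.cos φ * Real.sin θ) + a 1 * Real.cos φ * Real.cos θ + a 2 * Real.sin φ)
        * Real.sin w) := by
  simp [orbitPoint, PiLp.inner_apply, Fin.sum_univ_three]
  ring

/-- Pythagoras: the coefficients of `cos w` and `sin w` in `inner_orbitPoint` are the coordinates of
`a` in an orthonormal frame of the orbital plane. -/
theorem orbit_frame_sq (a : Space3) (θ φ : ℝ) :
    (a 0 * Real.cos θ + a 1 * Real.sin θ) ^ 2
      + (-(a 0 * Real.cos φ * Real.sin θ) + a 1 * Real.cos φ * Real.cos θ + a 2 * Real.sin φ) ^ 2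
      = ‖a‖ ^ 2 - inner ℝ a (orbitNormal θ φ) ^ 2 := by
  rw [EuclideanSpace.norm_sq_eq]
  simp [orbitNormal, PiLp.inner_apply, Fin.sum_univ_three]
  have h1 := Real.sin_sq_add_cos_sq θ
  have h2 := Real.sin_sq_add_cos_sq φ
  rw [← sub_eq_zero] at h1 h2
  grind

/-- By periodicity the window may be centred at `w₀`, where the set is an interval of half-width
`arccos x`. -/
theorem volume_cos_sub_ge {x : ℝ} (hx : 0 ≤ x) (w₀ : ℝ) :
    volume ({w | x ≤ Real.cos (w - w₀)} ∩ Ico 0 (2 * Real.pi))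
      = ENNReal.ofReal (2 * Real.arcsin √(1 - x ^ 2)) := by
  have hpi := Real.pi_pos
  have hmeas : MeasurableSet {w | x ≤ Real.cos (w - w₀)} :=
    measurableSet_le measurable_const (by fun_prop)
  have hper : volume ({w | x ≤ Real.cos (w - w₀)} ∩ Ioc 0 (0 + 2 * Real.pi))
      = volume ({w | x ≤ Real.cos (w - w₀)} ∩ Ioc (w₀ - Real.pi) (w₀ - Real.pi + 2 * Real.pi)) := by
    refine (isAddFundamentalDomain_Ioc Real.two_pi_pos 0).measure_set_eq
      (isAddFundamentalDomain_Ioc Real.two_pi_pos _) hmeas ?_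
    rintro ⟨g, hg⟩
    obtain ⟨n, rfl⟩ := AddSubgroup.mem_zmultiples_iff.1 hg
    ext w
    simp only [mem_preimage, mem_ofPred_eq, AddSubgroup.vadd_def, vadd_eq_add]
    rw [show n • (2 * Real.pi) + w - w₀ = (w - w₀) + n * (2 * Real.pi) by simp; ring,
      Real.cos_add_int_mul_two_pi]
  have hae : volume ({w | x ≤ Real.cos (w - w₀)} ∩ Ico 0 (2 * Real.pi))
      = volume ({w | x ≤ Real.cos (w - w₀)} ∩ Ioc 0 (0 + 2 * Real.pi)) := by
    rw [zero_add]
    exact measure_congr ((ae_eq_refl _).inter Ico_ae_eq_Ioc)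
  rw [hae, hper]
  -- For `x > 1` the set is empty, and the right side vanishes because `√` is `0` on negative
  -- numbers.
  rcases lt_or_ge 1 x with h1 | h1
  · have : {w | x ≤ Real.cos (w - w₀)} = ∅ := by
      ext w
      simp only [mem_ofPred_eq, mem_empty_iff_false, iff_false, not_le]
      exact (Real.cos_le_one _).trans_lt h1
    rw [this, Real.sqrt_eq_zero_of_nonpos (by nlinarith)]
    simp
  rw [← Real.arccos_eq_arcsin hx]
  have hle : Real.arccos x ≤ Real.pi / 2 := Real.arccos_le_pi_div_two.2 hx
  have : {w | x ≤ Real.cos (w - w₀)} ∩ Ioc (w₀ - Real.pi) (w₀ - Real.pi + 2 * Real.pi)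
      = Icc (w₀ - Real.arccos x) (w₀ + Real.arccos x) := by
    ext w
    simp only [mem_inter_iff, mem_ofPred_eq, mem_Ioc, mem_Icc]
    have h0 := Real.arccos_nonneg x
    have hiff : |w - w₀| ≤ Real.pi → (x ≤ Real.cos (w - w₀) ↔ |w - w₀| ≤ Real.arccos x) := by
      intro h
      rw [← Real.cos_abs (w - w₀)]
      conv_lhs => rw [← Real.cos_arccos (by linarith) h1]
      exact Real.strictAntiOn_cos.le_iff_ge ⟨h0, by linarith⟩ ⟨abs_nonneg _, h⟩
    constructor
    · rintro ⟨h, h2, h3⟩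
      have := (hiff (abs_le.2 ⟨by linarith, by linarith⟩)).1 h
      rw [abs_le] at this
      constructor <;> linarith [this.1, this.2]
    · rintro ⟨h2, h3⟩
      refine ⟨(hiff (abs_le.2 ⟨by linarith, by linarith⟩)).2 (abs_le.2 ⟨by linarith, by linarith⟩),
        by linarith, by linarith⟩
  rw [this, Real.volume_Icc]
  congr 1
  ring

theorem volume_cos_sin_ge {A B c : ℝ} (hc : 0 ≤ c) (hAB : 0 < A ^ 2 + B ^ 2) :
    volume ({w | c ≤ A * Real.cos w + B * Real.sin w} ∩ Ico 0 (2 * Real.pi))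
      = ENNReal.ofReal (2 * Real.arcsin √(1 - c ^ 2 / (A ^ 2 + B ^ 2))) := by
  have hR : 0 < √(A ^ 2 + B ^ 2) := Real.sqrt_pos.2 hAB
  have hR2 := Real.sq_sqrt hAB.le
  set R := √(A ^ 2 + B ^ 2) with hRdef
  obtain ⟨w₀, hA, hB⟩ : ∃ w₀, A = R * Real.cos w₀ ∧ B = R * Real.sin w₀ := by
    refine ⟨Complex.arg ⟨A, B⟩, ?_, ?_⟩
    · have := Complex.norm_mul_cos_arg ⟨A, B⟩
      rwa [Complex.norm_eq_sqrt_sq_add_sq, eq_comm] at this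
    · have := Complex.norm_mul_sin_arg ⟨A, B⟩
      rwa [Complex.norm_eq_sqrt_sq_add_sq, eq_comm] at this
  have hset : {w | c ≤ A * Real.cos w + B * Real.sin w}
      = {w | c / R ≤ Real.cos (w - w₀)} := by
    ext w
    simp only [mem_ofPred_eq]
    rw [div_le_iff₀ hR, Real.cos_sub, show A * Real.cos w + B * Real.sin w
      = (Real.cos w * Real.cos w₀ + Real.sin w * Real.sin w₀) * R by
        linear_combination Real.cos w * hA + Real.sin w * hB]
  rw [hset, volume_cos_sub_ge (by positivity), div_pow, hR2]

/-! ### The Laplace functional of a Poisson point process -/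

namespace IsPoissonPP

open Filter Topology

variable {Ω X : Type*} [MeasurableSpace Ω] [MeasurableSpace X] {P : Measure Ω}
  {N : Ω → Measure X} {Λ : Measure X}

theorem measurable_count (h : IsPoissonPP P N Λ) {B : Set X} (hB : MeasurableSet B) :
    Measurable fun ω => N ω B :=
  (Measure.measurable_coe hB).comp h.measurable

theorem map_count [IsProbabilityMeasure P] (h : IsPoissonPP P N Λ) {B : Set X}
    (hB : MeasurableSet B) (hfin : Λ B ≠ ⊤) :
    P.map (fun ω => N ω B)
      = (poissonMeasure (Λ B).toNNReal).map (Nat.cast : ℕ → ENNReal) := by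
  have hm := h.measurable_count hB
  have : IsProbabilityMeasure (P.map fun ω => N ω B) := Measure.isProbabilityMeasure_map hm.aemeasurable
  have : IsProbabilityMeasure
      ((poissonMeasure (Λ B).toNNReal).map (Nat.cast : ℕ → ENNReal)) :=
    Measure.isProbabilityMeasure_map (by fun_prop)
  symm
  -- Between probability measures an inequality is an equality, so it need not be shown separately
  -- that the count is almost surely a natural number.
  refine Measure.eq_of_le_of_measure_univ_eq ?_ (by simp)
  refine Measure.le_iff.2 fun S hS => ?_
  rw [Measure.map_apply .of_discrete hS, Measure.map_apply hm hS]
  set T : Set ℕ := Nat.cast ⁻¹' S with hT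
  have hpo : poissonMeasure (Λ B).toNNReal T
      = ∑' k : T, poissonMeasure (Λ B).toNNReal {(k : ℕ)} := by
    conv_lhs => rw [← biUnion_of_singleton T]
    exact measure_biUnion T.to_countable
      (fun i _ j _ hij => by simpa [Function.onFun] using hij) fun _ _ => .of_discrete
  rw [hpo]
  simp_rw [← h.count_law B hB hfin]
  rw [← measure_biUnion (f := fun k : ℕ => {ω | N ω B = k}) T.to_countable]
  · refine measure_mono (iUnion₂_subset fun k hk ω hω => ?_)
    rw [mem_preimage, show N ω B = k from hω]
    exact hk
  · intro i _ j _ hij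
    refine Set.disjoint_left.2 fun ω hi hj => hij ?_
    have : (i : ENNReal) = j := (show N ω B = i from hi).symm.trans hj
    exact_mod_cast this
  · exact fun k _ => hm (measurableSet_singleton _)

theorem ae_isFiniteMeasure [IsProbabilityMeasure P] [IsFiniteMeasure Λ] (h : IsPoissonPP P N Λ) :
    ∀ᵐ ω ∂P, IsFiniteMeasure (N ω) := by
  have h1 : ∀ᵐ y ∂(P.map fun ω => N ω univ), y < ⊤ := by
    rw [h.map_count .univ (measure_ne_top _ _)]
    refine (ae_map_iff Measurable.of_discrete.aemeasurable measurableSet_Iio).2 ?_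
    exact ae_of_all _ fun k => ENNReal.natCast_lt_top k
  filter_upwards [ae_of_ae_map (h.measurable_count .univ).aemeasurable h1] with ω hω
  exact ⟨hω⟩

theorem integral_exp_neg_mul_count [IsProbabilityMeasure P] (h : IsPoissonPP P N Λ) {B : Set X}
    (hB : MeasurableSet B) (hfin : Λ B ≠ ⊤) (c : ℝ) :
    ∫ ω, Real.exp (-(c * (N ω B).toReal)) ∂P
      = Real.exp (-(Λ.real B * (1 - Real.exp (-c)))) := by
  have hg : Measurable fun y : ENNReal => Real.exp (-(c * y.toReal)) := by fun_prop
  rw [← integral_map (f := fun y : ENNReal => Real.exp (-(c * y.toReal)))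
      (h.measurable_count hB).aemeasurable hg.aestronglyMeasurable,
    h.map_count hB hfin, integral_map (by fun_prop) hg.aestronglyMeasurable,
    integral_poissonMeasure]
  have hr : ((Λ B).toNNReal : ℝ) = Λ.real B := rfl
  rw [hr]
  have hsum := NormedSpace.expSeries_div_hasSum_exp (Λ.real B * Real.exp (-c))
  rw [← Real.exp_eq_exp_ℝ] at hsum
  have := hsum.mul_left (Real.exp (-Λ.real B))
  rw [← Real.exp_add] at this
  convert! this.tsum_eq using 2
  · ext k
    rw [smul_eq_mul, mul_pow, ← Real.exp_nat_mul, ENNReal.toReal_natCast,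
      show (k : ℝ) * -c = -(c * k) by ring]
    ring
  · ring

/-- The level sets of `g` are disjoint, so their counts are independent and the expectation factors
into Poisson Laplace transforms. The measurability half serves the dominated convergence in the next
lemma. -/
theorem integral_exp_neg_simpleFunc [IsProbabilityMeasure P] [IsFiniteMeasure Λ]
    (h : IsPoissonPP P N Λ) (g : SimpleFunc X ℝ) :
    AEStronglyMeasurable (fun ω => Real.exp (-∫ x, g x ∂N ω)) P ∧
    ∫ ω, Real.exp (-∫ x, g x ∂N ω) ∂P = Real.exp (-∫ x, (1 - Real.exp (-g x)) ∂Λ) := by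
  have hint : ∀ (ν : Measure X) [IsFiniteMeasure ν] (g : SimpleFunc X ℝ), Integrable g ν :=
    fun ν _ g => g.integrable_of_isFiniteMeasure
  set e := g.range.equivFin.symm
  set B : Fin g.range.card → Set X := fun j => g ⁻¹' {(e j : ℝ)} with hBdef
  have hB : ∀ j, MeasurableSet (B j) := fun j => g.measurableSet_fiber _
  have hdisj : Pairwise fun j j' => Disjoint (B j) (B j') := by
    intro i j hij
    refine Disjoint.preimage _ (disjoint_singleton.2 fun he => hij (e.injective (Subtype.ext he)))
  have hsum : ∀ (ν : Measure X) (F : ℝ → ℝ),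
      ∑ y ∈ g.range, ν.real (g ⁻¹' {y}) • F y = ∑ j, F (e j) * (ν (B j)).toReal := by
    intro ν F
    rw [← Finset.sum_coe_sort, ← Equiv.sum_comp e]
    simp [hBdef, Measure.real, mul_comm]
  have hae : (fun ω => Real.exp (-∫ x, g x ∂N ω))
      =ᵐ[P] fun ω => ∏ j, Real.exp (-((e j : ℝ) * (N ω (B j)).toReal)) := by
    filter_upwards [h.ae_isFiniteMeasure] with ω hω
    rw [g.integral_eq_sum (hint _ g), hsum (N ω) fun y => y, ← Real.exp_sum, Finset.sum_neg_distrib]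
  have hmeas : ∀ j, Measurable fun ω => N ω (B j) := fun j => h.measurable_count (hB j)
  refine ⟨AEStronglyMeasurable.congr (Measurable.aestronglyMeasurable ?_) hae.symm, ?_⟩
  · fun_prop
  rw [integral_congr_ae hae, (h.indep _ B hB hdisj).integral_fun_prod_comp
    (f := fun j y => Real.exp (-((e j : ℝ) * y.toReal))) (fun j => (hmeas j).aemeasurable)
    fun j => Measurable.aestronglyMeasurable (by fun_prop)]
  simp_rw [h.integral_exp_neg_mul_count (hB _) (measure_ne_top _ _)]
  rw [← Real.exp_sum, Finset.sum_neg_distrib]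
  congr 2
  calc ∑ j, Λ.real (B j) * (1 - Real.exp (-(e j : ℝ)))
      = ∑ y ∈ g.range, Λ.real (g ⁻¹' {y}) • (1 - Real.exp (-y)) := by
        rw [hsum Λ fun y => 1 - Real.exp (-y)]
        exact Finset.sum_congr rfl fun j _ => mul_comm _ _
    _ = ∫ x, (g.map fun y => 1 - Real.exp (-y)) x ∂Λ := by
        rw [← SimpleFunc.integral_eq_integral _ (hint Λ _),
          SimpleFunc.map_integral g _ (hint Λ g) (by simp)]

theorem integral_exp_neg_integral [IsProbabilityMeasure P] [IsFiniteMeasure Λ]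
    (h : IsPoissonPP P N Λ) {f : X → ℝ} (hf : Measurable f) {C : ℝ} (h0 : ∀ x, 0 ≤ f x)
    (hC : ∀ x, f x ≤ C) :
    ∫ ω, Real.exp (-∫ x, f x ∂N ω) ∂P = Real.exp (-∫ x, (1 - Real.exp (-f x)) ∂Λ) := by
  -- Approximation inside `Ici 0` keeps the exponentials at most `1`. Dominated convergence is then
  -- used for `N ω`, for `P` and for `Λ`.
  set g : ℕ → SimpleFunc X ℝ := SimpleFunc.approxOn f hf (Ici 0) 0 (mem_Ici.2 le_rfl)
  have hg0 : ∀ n x, 0 ≤ g n x := fun n x => SimpleFunc.approxOn_mem hf _ n x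
  have hgC : ∀ n x, ‖g n x‖ ≤ C + C := fun n x =>
    (SimpleFunc.norm_approxOn_zero_le hf _ x n).trans (by
      rw [Real.norm_of_nonneg (h0 x)]; linarith [hC x])
  have hlim : ∀ x, Tendsto (fun n => g n x) atTop (𝓝 (f x)) := fun x =>
    SimpleFunc.tendsto_approxOn hf _ (subset_closure (h0 x))
  have hl : Tendsto (fun n => ∫ ω, Real.exp (-∫ x, g n x ∂N ω) ∂P) atTop
      (𝓝 (∫ ω, Real.exp (-∫ x, f x ∂N ω) ∂P)) := by
    refine tendsto_integral_of_dominated_convergence (fun _ => 1)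
      (fun n => (h.integral_exp_neg_simpleFunc (g n)).1) (integrable_const _) ?_ ?_
    · refine fun n => ae_of_all _ fun ω => ?_
      rw [Real.norm_of_nonneg (Real.exp_nonneg _), Real.exp_le_one_iff, neg_nonpos]
      exact integral_nonneg (hg0 n)
    · filter_upwards [h.ae_isFiniteMeasure] with ω hω
      refine (Real.continuous_exp.tendsto _).comp (Tendsto.neg ?_)
      exact tendsto_integral_of_dominated_convergence (fun _ => C + C)
        (fun n => (g n).measurable.aestronglyMeasurable) (integrable_const _)
        (fun n => ae_of_all _ (hgC n)) (ae_of_all _ hlim)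
  refine tendsto_nhds_unique hl ?_
  simp_rw [(h.integral_exp_neg_simpleFunc (g _)).2]
  refine (Real.continuous_exp.tendsto _).comp (Tendsto.neg ?_)
  refine tendsto_integral_of_dominated_convergence (fun _ => 1) (fun n => ?_)
    (integrable_const _) (fun n => ae_of_all _ fun x => ?_) (ae_of_all _ fun x => ?_)
  · have := (g n).measurable
    exact Measurable.aestronglyMeasurable (by fun_prop)
  · have h1 : Real.exp (-g n x) ≤ 1 := Real.exp_le_one_iff.2 (neg_nonpos.2 (hg0 n x))
    rw [Real.norm_of_nonneg (by linarith)]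
    linarith [Real.exp_pos (-g n x)]
  · exact tendsto_const_nhds.sub ((Real.continuous_exp.tendsto _).comp (hlim x).neg)

end IsPoissonPP

/-! ### Void probabilities of the Cox process -/

theorem measurable_sum_range {Ω : Type*} [MeasurableSpace Ω] {K : Ω → ℕ} {F : ℕ → Ω → ℝ}
    (hK : Measurable K) (hF : ∀ j, Measurable (F j)) :
    Measurable fun ω => ∑ j ∈ Finset.range (K ω), F j ω := by
  have h : Measurable fun q : ℕ × Ω => ∑ j ∈ Finset.range q.1, F j q.2 :=
    measurable_from_prod_countable_right fun k =>
      Finset.measurable_fun_sum (Finset.range k) fun j _ => hF j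
  exact h.comp (hK.prodMk measurable_id)

theorem measurable_sum_range_measure {Ω X : Type*} [MeasurableSpace Ω] [MeasurableSpace X]
    {K : Ω → ℕ} {F : ℕ → Ω → Measure X} (hK : Measurable K) (hF : ∀ j, Measurable (F j)) :
    Measurable fun ω => ∑ j ∈ Finset.range (K ω), F j ω := by
  have h : Measurable fun q : ℕ × Ω => ∑ j ∈ Finset.range q.1, F j q.2 := by
    refine measurable_from_prod_countable_right fun k => ?_
    refine Measure.measurable_of_measurable_coe _ fun B hB => ?_
    simp only [Measure.coe_finsetSum, Finset.sum_apply]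
    exact Finset.measurable_fun_sum _ fun j _ => (Measure.measurable_coe hB).comp (hF j)
  exact h.comp (hK.prodMk measurable_id)

theorem continuous_orbitPoint (rs : ℝ) :
    Continuous fun q : (ℝ × ℝ) × ℝ => orbitPoint rs q.1.1 q.1.2 q.2 := by
  refine (PiLp.continuous_toLp 2 _).comp (continuous_pi fun i => ?_)
  fin_cases i <;> simp <;> fun_prop

/-- The mean number of satellites in `C` on the orbit with longitude and inclination `p`. -/
noncomputable def meanCount (mu rs : ℝ) (C : Set Space3) (p : ℝ × ℝ) : ENNReal :=
  ENNReal.ofReal (mu / (2 * Real.pi * rs)) * orbitLength rs p.1 p.2 C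

theorem orbitLength_apply (rs : ℝ) {C : Set Space3} (hC : MeasurableSet C) (p : ℝ × ℝ) :
    orbitLength rs p.1 p.2 C = ENNReal.ofReal rs *
      volume ({w | orbitPoint rs p.1 p.2 w ∈ C} ∩ Ico 0 (2 * Real.pi)) := by
  have hm : Measurable (orbitPoint rs p.1 p.2) :=
    ((continuous_orbitPoint rs).comp (Continuous.prodMk_right p)).measurable
  rw [orbitLength, Measure.map_apply hm hC, Measure.smul_apply,
    Measure.restrict_apply (hm hC), smul_eq_mul]
  rfl

theorem measurable_meanCount (mu rs : ℝ) {C : Set Space3} (hC : MeasurableSet C) :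
    Measurable (meanCount mu rs C) := by
  refine Measurable.const_mul ?_ _
  simp_rw [orbitLength_apply rs hC]
  refine Measurable.const_mul ?_ _
  have hS := (continuous_orbitPoint rs).measurable hC
  have heq : (fun p : ℝ × ℝ => volume ({w | orbitPoint rs p.1 p.2 w ∈ C} ∩ Ico 0 (2 * Real.pi)))
      = fun p => (volume : Measure ℝ).restrict (Ico 0 (2 * Real.pi)) (Prod.mk p ⁻¹'
        ((fun q : (ℝ × ℝ) × ℝ => orbitPoint rs q.1.1 q.1.2 q.2) ⁻¹' C)) := by
    ext p
    rw [Measure.restrict_apply' measurableSet_Ico]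
    rfl
  rw [heq]
  exact measurable_measure_prodMk_left hS

theorem meanCount_le {mu rs : ℝ} (hmu : 0 ≤ mu) (hrs : 0 < rs) {C : Set Space3}
    (hC : MeasurableSet C) (p : ℝ × ℝ) : meanCount mu rs C p ≤ ENNReal.ofReal mu := by
  rw [meanCount, orbitLength_apply rs hC]
  calc _ ≤ ENNReal.ofReal (mu / (2 * Real.pi * rs)) *
        (ENNReal.ofReal rs * volume (Ico 0 (2 * Real.pi))) := by
        gcongr
        exact inter_subset_right
    _ = ENNReal.ofReal mu := by
        rw [Real.volume_Ico, ← ENNReal.ofReal_mul hrs.le, ← ENNReal.ofReal_mul (by positivity)]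
        congr 1
        field_simp
        ring

instance isFiniteMeasure_orbitIntensity (lam : ℝ) : IsFiniteMeasure (orbitIntensity lam) := by
  refine isFiniteMeasure_withDensity_ofReal (Integrable.hasFiniteIntegral ?_)
  have : IsFiniteMeasure
      ((volume : Measure (ℝ × ℝ)).restrict (Ico 0 Real.pi ×ˢ Ico 0 Real.pi)) := by
    refine ⟨?_⟩
    rw [Measure.restrict_apply_univ, Measure.volume_eq_prod, Measure.prod_prod]
    simp [ENNReal.mul_lt_top]
  refine Integrable.of_bound (C := |lam| / (2 * Real.pi))
    (Measurable.aestronglyMeasurable (by fun_prop)) (ae_of_all _ fun p => ?_)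
  rw [Real.norm_eq_abs, abs_div, abs_mul, abs_of_pos Real.two_pi_pos]
  gcongr
  exact mul_le_of_le_one_right (abs_nonneg _) (Real.abs_sin_le_one _)

namespace SatelliteNetwork

variable {Ω : Type*} [MeasurableSpace Ω] (S : SatelliteNetwork Ω)

theorem measurable_satellite (rs : ℝ) (i j : ℕ) : Measurable (S.satellite rs i j) :=
  Measurable.comp (g := fun q : (ℝ × ℝ) × ℝ => orbitPoint rs q.1.1 q.1.2 q.2)
    (f := fun ω => (S.orbit i ω, S.arg i j ω)) (continuous_orbitPoint rs).measurable
    ((S.measurable_orbit i).prodMk (S.measurable_arg i j))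

theorem measurable_satOnOrbit (rs : ℝ) (i : ℕ) : Measurable (S.satOnOrbit rs i) :=
  measurable_sum_range_measure (S.measurable_numSat i) fun j =>
    Measure.measurable_dirac.comp (S.measurable_satellite rs i j)

theorem measurable_satPoints (rs : ℝ) : Measurable (S.satPoints rs) :=
  measurable_sum_range_measure S.measurable_numOrbits fun i => S.measurable_satOnOrbit rs i

theorem orbitSigma_le : S.orbitSigma ≤ (inferInstance : MeasurableSpace Ω) :=
  Measurable.comap_le (S.measurable_numOrbits.prodMk (measurable_pi_lambda _ S.measurable_orbit))

theorem measurableSet_numOrbits_eq (n : ℕ) :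
    MeasurableSet[S.orbitSigma] {ω | S.numOrbits ω = n} :=
  ⟨{q | q.1 = n}, measurable_fst (measurableSet_singleton n), rfl⟩

theorem satPoints_apply_eq_zero_iff {rs : ℝ} {ω : Ω} {C : Set Space3} :
    S.satPoints rs ω C = 0 ↔ ∀ i < S.numOrbits ω, S.satOnOrbit rs i ω C = 0 := by
  simp [satPoints, Finset.sum_apply]

theorem integral_orbitPoints (ω : Ω) (f : ℝ × ℝ → ℝ) :
    ∫ p, f p ∂(S.orbitPoints ω) = ∑ i ∈ Finset.range (S.numOrbits ω), f (S.orbit i ω) := by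
  rw [orbitPoints, integral_finsetSum_measure fun i _ => integrable_dirac (by simp)]
  simp

theorem satIntensity_apply (mu rs : ℝ) (i : ℕ) (ω : Ω) (C : Set Space3) :
    S.satIntensity mu rs i ω C = meanCount mu rs C (S.orbit i ω) := rfl

variable {S}

/-- The conditional law is known only for orbits that exist, so the space is split by the number of
orbits. These events belong to `orbitSigma`, hence the conditional probability may be integrated
over each. -/
theorem IsCox.void_probability {P : Measure Ω} [IsProbabilityMeasure P] {lam mu rs : ℝ}
    (hS : S.IsCox P lam mu rs) (hmu : 0 ≤ mu) (hrs : 0 < rs) {C : Set Space3}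
    (hC : MeasurableSet C) :
    P.real {ω | S.satPoints rs ω C = 0}
      = Real.exp (-∫ p, (1 - Real.exp (-(meanCount mu rs C p).toReal)) ∂(orbitIntensity lam)) := by
  set q : ℝ × ℝ → ℝ := fun p => (meanCount mu rs C p).toReal with hq
  have hqm : Measurable q := (measurable_meanCount mu rs hC).ennreal_toReal
  have hq0 : ∀ p, 0 ≤ q p := fun p => ENNReal.toReal_nonneg
  have hqmu : ∀ p, q p ≤ mu := fun p => by
    rw [← ENNReal.toReal_ofReal hmu]
    exact ENNReal.toReal_mono ENNReal.ofReal_ne_top (meanCount_le hmu hrs hC p)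
  rw [← hS.orbits.integral_exp_neg_integral hqm hq0 hqmu]
  set A : Set Ω := {ω | S.satPoints rs ω C = 0} with hA
  set E : ℕ → Set Ω := fun n => {ω | S.numOrbits ω = n} with hE
  have hEσ : ∀ n, MeasurableSet[S.orbitSigma] (E n) := S.measurableSet_numOrbits_eq
  have hEm : ∀ n, MeasurableSet (E n) := fun n => S.orbitSigma_le _ (hEσ n)
  have hEd : Pairwise (Function.onFun Disjoint E) := by
    intro m n hmn
    refine Set.disjoint_left.2 fun ω hm hn => hmn ?_
    exact (show S.numOrbits ω = m from hm).symm.trans hn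
  have hEu : ⋃ n, E n = univ := by ext ω; simp [hE]
  have hAm : MeasurableSet A :=
    (Measure.measurable_coe hC).comp (S.measurable_satPoints rs) (measurableSet_singleton 0)
  have key : ∀ n, ∫ ω in E n, A.indicator (fun _ => (1 : ℝ)) ω ∂P
      = ∫ ω in E n, Real.exp (-∫ p, q p ∂(S.orbitPoints ω)) ∂P := by
    intro n
    -- `A'` agrees with `A` on `E n` but involves a deterministic number of orbits.
    set A' : Set Ω := {ω | ∀ i ∈ Finset.range n, ∀ _j : Fin 1,
      S.satOnOrbit rs i ω C = ((0 : ℕ) : ENNReal)} with hA'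
    have hA'm : MeasurableSet A' := by
      have : A' = ⋂ i ∈ Finset.range n, {ω | S.satOnOrbit rs i ω C = 0} := by
        ext ω; simp [hA']
      rw [this]
      exact Finset.measurableSet_biInter _ fun i _ =>
        (Measure.measurable_coe hC).comp (S.measurable_satOnOrbit rs i) (measurableSet_singleton 0)
    have hAA' : ∀ ω ∈ E n, A.indicator (fun _ => (1 : ℝ)) ω = A'.indicator (fun _ => (1 : ℝ)) ω := by
      intro ω hω
      have : ω ∈ A ↔ ω ∈ A' := by
        simp only [hA, hA', mem_ofPred_eq, S.satPoints_apply_eq_zero_iff,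
          show S.numOrbits ω = n from hω]
        simp
      simp only [indicator, this]
    rw [setIntegral_congr_fun (hEm n) hAA', ← setIntegral_condExp S.orbitSigma_le
      ((integrable_const (1 : ℝ)).indicator hA'm) (hEσ n)]
    refine setIntegral_congr_ae (hEm n) ?_
    filter_upwards [hS.satellites (Finset.range n) 1 (fun _ => C) (fun _ _ => 0) (fun _ => hC)
      (fun i j hij => (hij (Subsingleton.elim i j)).elim)] with ω hω hωn
    have hn : S.numOrbits ω = n := hωn
    refine (hω fun i hi => hn ▸ Finset.mem_range.1 hi).trans ?_
    rw [S.integral_orbitPoints ω q, hn, ← Finset.sum_neg_distrib, Real.exp_sum]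
    refine Finset.prod_congr rfl fun i _ => ?_
    rw [Fin.prod_univ_one, poissonMeasure_real_singleton, S.satIntensity_apply]
    simp only [pow_zero, mul_one, Nat.factorial_zero, Nat.cast_one, div_one]
    rfl
  have hF : Integrable (fun ω => Real.exp (-∫ p, q p ∂(S.orbitPoints ω))) P := by
    have hsum : Measurable fun ω => ∫ p, q p ∂(S.orbitPoints ω) := by
      simp_rw [S.integral_orbitPoints _ q]
      exact measurable_sum_range S.measurable_numOrbits fun i => hqm.comp (S.measurable_orbit i)
    refine Integrable.of_bound (C := 1) (Measurable.aestronglyMeasurable (by fun_prop))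
      (ae_of_all _ fun ω => ?_)
    rw [Real.norm_of_nonneg (Real.exp_nonneg _), Real.exp_le_one_iff, neg_nonpos]
    exact integral_nonneg hq0
  have h1 := hasSum_integral_iUnion hEm hEd
    ((integrable_const (1 : ℝ)).indicator hAm : Integrable (A.indicator fun _ => (1 : ℝ)) P).integrableOn
  have h2 := hasSum_integral_iUnion hEm hEd hF.integrableOn
  rw [hEu, setIntegral_univ] at h1 h2
  simp_rw [key] at h1
  rw [← h1.unique h2]
  exact (integral_indicator_one hAm).symm

end SatelliteNetwork

/-! ### Isotropy of the orbit process -/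

/-- The point of the unit sphere with longitude `t` and colatitude `φ`. -/
noncomputable def spherePoint (t φ : ℝ) : Space3 :=
  !₂[Real.sin φ * Real.cos t, Real.sin φ * Real.sin t, Real.cos φ]

theorem inner_spherePoint (a : Space3) (t φ : ℝ) : inner ℝ a (spherePoint t φ)
    = a 0 * (Real.sin φ * Real.cos t) + a 1 * (Real.sin φ * Real.sin t) + a 2 * Real.cos φ := by
  simp [spherePoint, PiLp.inner_apply, Fin.sum_univ_three]
  ring

/-- The integral over a half meridian of a function of the squared inner product with `a`. -/
noncomputable def meridianIntegral (g : ℝ → ENNReal) (a : Space3) (t : ℝ) : ENNReal :=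
  ∫⁻ φ in Ioc 0 Real.pi, ENNReal.ofReal (Real.sin φ) * g (inner ℝ a (spherePoint t φ) ^ 2)

theorem measurePreserving_coords :
    MeasurePreserving (fun x : Space3 => (x 2, (x 0, x 1))) := by
  have h1 := PiLp.volume_preserving_ofLp (Fin 3)
  have h2 := volume_preserving_piFinSuccAbove (fun _ : Fin 3 => ℝ) 2
  have h3 := (MeasurePreserving.id (volume : Measure ℝ)).prod (volume_preserving_finTwoArrow ℝ)
  exact h3.comp (h2.comp h1)

/-- Plane polar coordinates twice: in the pair of coordinates `0`, `1`, then in the pair of height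
and horizontal radius. -/
theorem lintegral_spherical {F : ℝ × ℝ × ℝ → ENNReal} (hF : Measurable F) :
    ∫⁻ x : Space3, F (x 2, (x 0, x 1))
      = ∫⁻ t in Ioo (-Real.pi) Real.pi, ∫⁻ p in Ioi 0 ×ˢ Ioo (-Real.pi) Real.pi,
          ENNReal.ofReal p.1 * (ENNReal.ofReal (p.1 * Real.sin p.2) *
            F (p.1 * Real.cos p.2, (p.1 * Real.sin p.2 * Real.cos t,
              p.1 * Real.sin p.2 * Real.sin t))) := by
  rw [measurePreserving_coords.lintegral_comp hF, Measure.volume_eq_prod, lintegral_prod _ hF.aemeasurable]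
  have h1 : ∀ z : ℝ, ∫⁻ q : ℝ × ℝ, F (z, q)
      = ∫⁻ t in Ioo (-Real.pi) Real.pi, ∫⁻ ρ : ℝ,
          ENNReal.ofReal ρ * F (z, (ρ * Real.cos t, ρ * Real.sin t)) := by
    intro z
    rw [← lintegral_comp_polarCoord_symm, polarCoord_target, Measure.volume_eq_prod,
      ← Measure.prod_restrict, lintegral_prod_symm _ (by
        simp only [polarCoord_symm_apply, smul_eq_mul]; fun_prop)]
    refine lintegral_congr fun t => ?_
    -- `ENNReal.ofReal ρ` vanishes for `ρ ≤ 0`, so `ρ` may run over the whole line, as the second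
    -- polar change requires.
    rw [← lintegral_indicator measurableSet_Ioi]
    refine lintegral_congr fun ρ => ?_
    by_cases hρ : 0 < ρ
    · simp [hρ]
    · simp [hρ, ENNReal.ofReal_of_nonpos (not_lt.1 hρ)]
  simp_rw [h1]
  rw [lintegral_lintegral_swap (by fun_prop)]
  refine lintegral_congr fun t => ?_
  rw [← lintegral_prod (fun q : ℝ × ℝ =>
    ENNReal.ofReal q.2 * F (q.1, (q.2 * Real.cos t, q.2 * Real.sin t))) (by fun_prop),
    ← Measure.volume_eq_prod, ← lintegral_comp_polarCoord_symm, polarCoord_target]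
  simp only [polarCoord_symm_apply, smul_eq_mul]

theorem lintegral_sq_Ioo_ne_top : ∫⁻ r in Ioo (0 : ℝ) 1, ENNReal.ofReal (r ^ 2) ≠ ⊤ := by
  refine ne_top_of_le_ne_top (b := ∫⁻ _ in Ioo (0 : ℝ) 1, 1) (by simp)
    (setLIntegral_mono measurable_const fun r hr => ?_)
  rw [← ENNReal.ofReal_one]
  exact ENNReal.ofReal_le_ofReal (pow_le_one₀ hr.1.le hr.2.le)

theorem lintegral_sq_Ioo_ne_zero : ∫⁻ r in Ioo (0 : ℝ) 1, ENNReal.ofReal (r ^ 2) ≠ 0 := by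
  refine (setLIntegral_pos_iff (by fun_prop)).2 ?_ |>.ne'
  have : Function.support (fun r : ℝ => ENNReal.ofReal (r ^ 2)) ∩ Ioo 0 1 = Ioo 0 1 := by
    refine inter_eq_right.2 fun r hr => ?_
    simpa using hr.1.ne'
  rw [this]
  simp

/-- The integrand is homogeneous of degree zero inside the ball, so the radial integral splits off.
This replaces surface measure by Lebesgue measure, whose invariance under isometries is at hand; the
radial factor need only be finite and nonzero. -/
theorem lintegral_meridianIntegral {g : ℝ → ENNReal} (hg : Measurable g) (a : Space3) :
    ∫⁻ x : Space3, (if ‖x‖ < 1 then g (inner ℝ a x ^ 2 / ‖x‖ ^ 2) else 0)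
      = (∫⁻ r in Ioo (0 : ℝ) 1, ENNReal.ofReal (r ^ 2))
        * ∫⁻ t in Ioo (-Real.pi) Real.pi, meridianIntegral g a t := by
  set F : ℝ × ℝ × ℝ → ENNReal := fun q => if q.2.1 ^ 2 + q.2.2 ^ 2 + q.1 ^ 2 < 1 then
    g ((a 0 * q.2.1 + a 1 * q.2.2 + a 2 * q.1) ^ 2 / (q.2.1 ^ 2 + q.2.2 ^ 2 + q.1 ^ 2)) else 0
    with hFdef
  have hF : Measurable F := Measurable.ite (measurableSet_lt (by fun_prop) measurable_const)
    (by fun_prop) measurable_const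
  have h1 : ∀ x : Space3, (if ‖x‖ < 1 then g (inner ℝ a x ^ 2 / ‖x‖ ^ 2) else 0)
      = F (x 2, (x 0, x 1)) := by
    intro x
    have hn : ‖x‖ ^ 2 = x 0 ^ 2 + x 1 ^ 2 + x 2 ^ 2 := by
      rw [EuclideanSpace.norm_sq_eq]; simp [Fin.sum_univ_three]
    have hi : inner ℝ a x = a 0 * x 0 + a 1 * x 1 + a 2 * x 2 := by
      simp [PiLp.inner_apply, Fin.sum_univ_three]; ring
    simp only [hFdef, ← hn, hi, sq_lt_one_iff₀ (norm_nonneg x)]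
  simp_rw [h1]
  rw [lintegral_spherical hF, ← lintegral_const_mul']
  swap
  · exact lintegral_sq_Ioo_ne_top
  refine lintegral_congr fun t => ?_
  have h2 : ∀ p ∈ Ioi (0 : ℝ) ×ˢ Ioo (-Real.pi) Real.pi,
      ENNReal.ofReal p.1 * (ENNReal.ofReal (p.1 * Real.sin p.2) *
            F (p.1 * Real.cos p.2, (p.1 * Real.sin p.2 * Real.cos t,
              p.1 * Real.sin p.2 * Real.sin t)))
      = ((Ioo (0 : ℝ) 1).indicator (fun r => ENNReal.ofReal (r ^ 2)) p.1) *
        (ENNReal.ofReal (Real.sin p.2) * g (inner ℝ a (spherePoint t p.2) ^ 2)) := by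
    rintro ⟨r, φ⟩ ⟨hr, -⟩
    simp only [mem_Ioi] at hr
    have hsq : (r * Real.sin φ * Real.cos t) ^ 2 + (r * Real.sin φ * Real.sin t) ^ 2
        + (r * Real.cos φ) ^ 2 = r ^ 2 := by
      linear_combination r ^ 2 * Real.sin φ ^ 2 * Real.sin_sq_add_cos_sq t
        + r ^ 2 * Real.sin_sq_add_cos_sq φ
    have hin : a 0 * (r * Real.sin φ * Real.cos t) + a 1 * (r * Real.sin φ * Real.sin t)
        + a 2 * (r * Real.cos φ) = r * inner ℝ a (spherePoint t φ) := by
      rw [inner_spherePoint]; ring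
    simp only [hFdef, hsq, hin]
    by_cases h : r < 1
    · rw [if_pos ((sq_lt_one_iff₀ hr.le).2 h), indicator_of_mem (mem_Ioo.2 ⟨hr, h⟩), mul_pow,
        mul_div_cancel_left₀ _ (by positivity), ENNReal.ofReal_mul hr.le, pow_two r,
        ENNReal.ofReal_mul hr.le]
      ring
    · rw [if_neg (mt (sq_lt_one_iff₀ hr.le).1 h), indicator_of_notMem (fun hm => h hm.2)]
      simp
  have hin : Measurable fun φ => ENNReal.ofReal (Real.sin φ) *
      g (inner ℝ a (spherePoint t φ) ^ 2) := by
    simp_rw [inner_spherePoint]; fun_prop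
  rw [setLIntegral_congr_fun (measurableSet_Ioi.prod measurableSet_Ioo) h2,
    Measure.volume_eq_prod, ← Measure.prod_restrict, lintegral_prod_mul
      ((Measurable.indicator (by fun_prop) measurableSet_Ioo).aemeasurable) hin.aemeasurable,
    setLIntegral_indicator measurableSet_Ioo]
  congr 1
  · congr 2
    ext r
    simp only [mem_inter_iff, mem_Ioo, mem_Ioi]
    tauto
  · rw [meridianIntegral, ← lintegral_indicator measurableSet_Ioo,
      ← lintegral_indicator measurableSet_Ioc]
    refine lintegral_congr_ae ?_
    filter_upwards [compl_mem_ae_iff.2 (measure_singleton Real.pi)] with φ hφ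
    have hne : φ ≠ Real.pi := hφ
    by_cases h0 : 0 < φ
    · have : φ ∈ Ioo (-Real.pi) Real.pi ↔ φ ∈ Ioc 0 Real.pi := by
        simp only [mem_Ioo, mem_Ioc]
        exact ⟨fun h => ⟨h0, h.2.le⟩, fun h => ⟨by linarith [Real.pi_pos], h.2.lt_of_ne hne⟩⟩
      simp only [indicator, this]
    · rw [indicator_of_notMem (fun h : φ ∈ Ioc 0 Real.pi => h0 h.1)]
      by_cases h1 : φ ∈ Ioo (-Real.pi) Real.pi
      · rw [indicator_of_mem h1, ENNReal.ofReal_of_nonpos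
          (Real.sin_nonpos_of_nonpos_of_neg_pi_le (not_lt.1 h0) h1.1.le), zero_mul]
      · rw [indicator_of_notMem h1]

/-- The reflection in the hyperplane orthogonal to `a - b` preserves volume and carries `a` to `b`.
-/
theorem lintegral_unit_ball_eq {g : ℝ → ENNReal} {a b : Space3} (hab : ‖a‖ = ‖b‖) :
    ∫⁻ x : Space3, (if ‖x‖ < 1 then g (inner ℝ a x ^ 2 / ‖x‖ ^ 2) else 0)
      = ∫⁻ x : Space3, (if ‖x‖ < 1 then g (inner ℝ b x ^ 2 / ‖x‖ ^ 2) else 0) := by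
  set L := (Submodule.span ℝ {a - b})ᗮ.reflection
  have hL : L a = b := Submodule.reflection_sub hab
  have := L.measurePreserving.lintegral_comp_emb L.toHomeomorph.measurableEmbedding
    fun x : Space3 => if ‖x‖ < 1 then g (inner ℝ b x ^ 2 / ‖x‖ ^ 2) else 0
  rw [← this]
  simp_rw [L.norm_map, ← hL, L.inner_map_map]

theorem spherePoint_add_pi (t φ : ℝ) :
    spherePoint (t + Real.pi) φ = -spherePoint t (Real.pi - φ) := by
  ext i
  fin_cases i <;> simp [spherePoint]

/-- A half turn in longitude is the antipodal map combined with `φ ↦ π - φ`, and the square ignores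
the sign. Thus longitudes in a half circle suffice. -/
theorem meridianIntegral_add_pi (g : ℝ → ENNReal) (a : Space3) (t : ℝ) :
    meridianIntegral g a (t + Real.pi) = meridianIntegral g a t := by
  have hIoo : ∀ f : ℝ → ENNReal, ∫⁻ φ in Ioc 0 Real.pi, f φ = ∫⁻ φ in Ioo 0 Real.pi, f φ :=
    fun f => setLIntegral_congr Ioo_ae_eq_Ioc.symm
  simp_rw [meridianIntegral, hIoo, spherePoint_add_pi, inner_neg_right, neg_sq]
  rw [← (Measure.measurePreserving_sub_left volume Real.pi).setLIntegral_comp_preimage_emb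
    (Homeomorph.subLeft Real.pi).measurableEmbedding]
  simp

theorem lintegral_Ioc_eq_of_periodic {K : ℝ → ENNReal} {T : ℝ} (hT : 0 < T)
    (hK : Function.Periodic K T) (a b : ℝ) :
    ∫⁻ t in Ioc a (a + T), K t = ∫⁻ t in Ioc b (b + T), K t := by
  refine (isAddFundamentalDomain_Ioc hT a).setLIntegral_eq (isAddFundamentalDomain_Ioc hT b) _ ?_
  rintro ⟨g, hg⟩ x
  obtain ⟨n, rfl⟩ := AddSubgroup.mem_zmultiples_iff.1 hg
  rw [AddSubgroup.vadd_def, vadd_eq_add, add_comm]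
  exact hK.zsmul n x

theorem lintegral_meridianIntegral_Ioo (g : ℝ → ENNReal) (a : Space3) :
    ∫⁻ t in Ioo (-Real.pi) Real.pi, meridianIntegral g a t
      = 2 * ∫⁻ t in Ioc 0 Real.pi, meridianIntegral g a t := by
  have hpi := Real.pi_pos
  have h := lintegral_Ioc_eq_of_periodic hpi (meridianIntegral_add_pi g a) (-Real.pi) 0
  rw [neg_add_cancel, zero_add] at h
  rw [setLIntegral_congr Ioo_ae_eq_Ioc,
    ← Ioc_union_Ioc_eq_Ioc (by linarith : -Real.pi ≤ 0) hpi.le,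
    lintegral_union measurableSet_Ioc (Ioc_disjoint_Ioc_of_le le_rfl), h, two_mul]

theorem lintegral_meridianIntegral_Ioc {g : ℝ → ENNReal} (hg : Measurable g) {a : Space3}
    (ha : ‖a‖ = 1) : ∫⁻ t in Ioc 0 Real.pi, meridianIntegral g a t
      = ENNReal.ofReal Real.pi *
        ∫⁻ φ in Ioc 0 Real.pi, ENNReal.ofReal (Real.sin φ) * g (Real.cos φ ^ 2) := by
  set b : Space3 := !₂[0, 0, 1]
  have hb : ‖b‖ = 1 := by simp [b, EuclideanSpace.norm_eq, Fin.sum_univ_three]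
  have h := lintegral_unit_ball_eq (g := g) (ha.trans hb.symm)
  rw [lintegral_meridianIntegral hg, lintegral_meridianIntegral hg,
    ENNReal.mul_right_inj lintegral_sq_Ioo_ne_zero lintegral_sq_Ioo_ne_top,
    lintegral_meridianIntegral_Ioo, lintegral_meridianIntegral_Ioo,
    ENNReal.mul_right_inj two_ne_zero ENNReal.ofNat_ne_top] at h
  rw [h]
  -- At the pole the inner product is `cos φ`, independent of `t`.
  have hm : ∀ t, meridianIntegral g b t
      = ∫⁻ φ in Ioc 0 Real.pi, ENNReal.ofReal (Real.sin φ) * g (Real.cos φ ^ 2) := by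
    intro t
    simp [meridianIntegral, inner_spherePoint, b]
  simp_rw [hm]
  rw [setLIntegral_const, Real.volume_Ioc, sub_zero, mul_comm]

theorem lintegral_orbitIntensity {lam : ℝ} (hlam : 0 ≤ lam) {g : ℝ → ENNReal} (hg : Measurable g)
    {a : Space3} (ha : ‖a‖ = 1) :
    ∫⁻ p, g (inner ℝ a (orbitNormal p.1 p.2) ^ 2) ∂(orbitIntensity lam)
      = ENNReal.ofReal (lam / 2) *
        ∫⁻ φ in Ioc 0 Real.pi, ENNReal.ofReal (Real.sin φ) * g (Real.cos φ ^ 2) := by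
  -- `orbitNormal θ φ` is `spherePoint (θ - π / 2) φ`; a quarter turn of `a` about the vertical axis
  -- absorbs the shift.
  set b : Space3 := !₂[-a 1, a 0, a 2]
  have hb : ‖b‖ = 1 := by
    rw [← ha, EuclideanSpace.norm_eq, EuclideanSpace.norm_eq]
    simp [b, Fin.sum_univ_three, add_comm]
  have hab : ∀ θ φ : ℝ, inner ℝ a (orbitNormal θ φ) = inner ℝ b (spherePoint θ φ) := by
    intro θ φ
    rw [inner_spherePoint]
    simp [orbitNormal, PiLp.inner_apply, Fin.sum_univ_three, b]
    ring
  have hm : Measurable fun p : ℝ × ℝ => g (inner ℝ b (spherePoint p.1 p.2) ^ 2) := by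
    simp_rw [inner_spherePoint]
    fun_prop
  simp_rw [hab]
  rw [orbitIntensity, lintegral_withDensity_eq_lintegral_mul _ (by fun_prop) hm,
    Measure.volume_eq_prod, setLIntegral_congr (t := Ioc 0 Real.pi ×ˢ Ioc 0 Real.pi)
      (Measure.set_prod_ae_eq Ico_ae_eq_Ioc Ico_ae_eq_Ioc),
    ← Measure.prod_restrict,
    lintegral_prod _ (Measurable.mul (by fun_prop) hm).aemeasurable]
  have hK : ∀ θ : ℝ, ∫⁻ φ in Ioc 0 Real.pi,
      ((fun p : ℝ × ℝ => ENNReal.ofReal (lam * Real.sin p.2 / (2 * Real.pi))) *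
        fun p : ℝ × ℝ => g (inner ℝ b (spherePoint p.1 p.2) ^ 2)) (θ, φ)
      = ENNReal.ofReal (lam / (2 * Real.pi)) * meridianIntegral g b θ := by
    intro θ
    rw [meridianIntegral, ← lintegral_const_mul' _ _ ENNReal.ofReal_ne_top]
    refine lintegral_congr fun φ => ?_
    rw [Pi.mul_apply, ← mul_assoc, ← ENNReal.ofReal_mul (by positivity), mul_div_right_comm]
  simp_rw [hK]
  rw [lintegral_const_mul' _ _ ENNReal.ofReal_ne_top, lintegral_meridianIntegral_Ioc hg hb,
    ← mul_assoc, ← ENNReal.ofReal_mul (by positivity)]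
  congr 2
  field_simp

/-! ### The void probability of a spherical cap -/

/-- The cap of the sphere of radius `rs` whose axis is the unit vector `a` and whose angular radius
has cosine `c`. -/
def sphericalCap (rs c : ℝ) (a : Space3) : Set Space3 :=
  {x | ‖x‖ = rs ∧ rs * c ≤ inner ℝ a x}

theorem measurableSet_sphericalCap (rs c : ℝ) (a : Space3) :
    MeasurableSet (sphericalCap rs c a) :=
  MeasurableSet.inter (s₁ := {x : Space3 | ‖x‖ = rs})
    (measurableSet_eq_fun measurable_norm measurable_const)
    (measurableSet_le (f := fun _ => rs * c) measurable_const
      (Measurable.const_inner measurable_id))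

/-- The projection of `a` to the orbital plane has squared length `1 - ⟪a, n⟫ ^ 2`, with `n` the
orbit normal. The hypothesis `hp` excludes a zero projection, for which the quotient is meaningless.
-/
theorem meanCount_sphericalCap {mu rs c : ℝ} (hmu : 0 ≤ mu) (hrs : 0 < rs) (hc : 0 ≤ c) {a : Space3}
    (ha : ‖a‖ = 1) {p : ℝ × ℝ} (hp : inner ℝ a (orbitNormal p.1 p.2) ^ 2 ≠ 1) :
    (meanCount mu rs (sphericalCap rs c a) p).toReal = mu / Real.pi *
      Real.arcsin √(1 - c ^ 2 / (1 - inner ℝ a (orbitNormal p.1 p.2) ^ 2)) := by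
  have hframe := orbit_frame_sq a p.1 p.2
  rw [ha, one_pow] at hframe
  set A := a 0 * Real.cos p.1 + a 1 * Real.sin p.1
  set B := -(a 0 * Real.cos p.2 * Real.sin p.1) + a 1 * Real.cos p.2 * Real.cos p.1
    + a 2 * Real.sin p.2
  have hpos : 0 < A ^ 2 + B ^ 2 :=
    lt_of_le_of_ne (by positivity) fun h => hp (by linarith)
  have hset : {w | orbitPoint rs p.1 p.2 w ∈ sphericalCap rs c a}
      = {w | c ≤ A * Real.cos w + B * Real.sin w} := by
    ext w
    simp only [sphericalCap, mem_ofPred_eq, norm_orbitPoint hrs.le, true_and, inner_orbitPoint]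
    exact mul_le_mul_iff_right₀ hrs
  have hsin : 0 ≤ Real.arcsin √(1 - c ^ 2 / (A ^ 2 + B ^ 2)) :=
    Real.arcsin_nonneg.2 (Real.sqrt_nonneg _)
  rw [meanCount, orbitLength_apply rs (measurableSet_sphericalCap rs c a), hset,
    volume_cos_sin_ge hc hpos, ← ENNReal.ofReal_mul hrs.le, ← ENNReal.ofReal_mul (by positivity),
    ENNReal.toReal_ofReal (by positivity), ← hframe]
  field_simp

/-- Isotropy applied to the indicator of `{1}`: the weight `sin φ` vanishes wherever `cos φ ^ 2 =
1`. -/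
theorem ae_inner_orbitNormal_sq_ne_one {lam : ℝ} (hlam : 0 ≤ lam) {a : Space3} (ha : ‖a‖ = 1) :
    ∀ᵐ p ∂(orbitIntensity lam), inner ℝ a (orbitNormal p.1 p.2) ^ 2 ≠ 1 := by
  have hg : Measurable (indicator {(1 : ℝ)} (1 : ℝ → ENNReal)) :=
    measurable_one.indicator (measurableSet_singleton 1)
  have h := lintegral_orbitIntensity hlam hg ha
  have h0 : ∫⁻ φ in Ioc 0 Real.pi, ENNReal.ofReal (Real.sin φ) *
      indicator {(1 : ℝ)} (1 : ℝ → ENNReal) (Real.cos φ ^ 2) = 0 := by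
    rw [setLIntegral_congr_fun (g := fun _ => 0) measurableSet_Ioc, lintegral_zero]
    intro φ _
    by_cases h1 : Real.cos φ ^ 2 = 1
    · have : Real.sin φ = 0 := by
        have := Real.sin_sq_add_cos_sq φ
        rw [h1] at this
        exact pow_eq_zero_iff two_ne_zero |>.1 (by linarith)
      simp [this]
    · simp [h1]
  have hm : Measurable fun p : ℝ × ℝ => inner ℝ a (orbitNormal p.1 p.2) ^ 2 := by
    simp only [orbitNormal, PiLp.inner_apply, Fin.sum_univ_three]
    simp
    fun_prop
  rw [h0, mul_zero, lintegral_eq_zero_iff (by exact hg.comp hm)] at h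
  filter_upwards [h] with p hp h1
  simp [h1] at hp

/-- Symmetry about `π / 2` gives a factor `2`, which cancels the half in `lam / 2`; then `φ ↦ π / 2
- φ` exchanges sine and cosine. -/
theorem integral_orbitIntensity {lam : ℝ} (hlam : 0 ≤ lam) {G : ℝ → ℝ} (hG : Measurable G)
    (hG0 : ∀ s, 0 ≤ G s) (hG1 : ∀ s, G s ≤ 1) {a : Space3} (ha : ‖a‖ = 1) :
    ∫ p, G (inner ℝ a (orbitNormal p.1 p.2) ^ 2) ∂(orbitIntensity lam)
      = lam * ∫ φ in (0 : ℝ)..Real.pi / 2, Real.cos φ * G (Real.sin φ ^ 2) := by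
  have hpi := Real.pi_pos
  have hm : Measurable fun p : ℝ × ℝ => inner ℝ a (orbitNormal p.1 p.2) ^ 2 := by
    simp only [orbitNormal, PiLp.inner_apply, Fin.sum_univ_three]
    simp
    fun_prop
  have hint : ∀ x y : ℝ, IntervalIntegrable (fun φ => Real.sin φ * G (Real.cos φ ^ 2)) volume x y := by
    intro x y
    refine intervalIntegrable_const (c := (1 : ℝ)) |>.mono_fun
      (Measurable.aestronglyMeasurable (by fun_prop)) (ae_of_all _ fun φ => ?_)
    simp only [norm_mul]
    rw [Real.norm_eq_abs, Real.norm_of_nonneg (hG0 _), norm_one]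
    exact mul_le_one₀ (Real.abs_sin_le_one φ) (hG0 _) (hG1 _)
  have h1 : ∫ φ in (0 : ℝ)..Real.pi / 2, Real.sin φ * G (Real.cos φ ^ 2)
      = ∫ φ in (0 : ℝ)..Real.pi / 2, Real.cos φ * G (Real.sin φ ^ 2) := by
    have := intervalIntegral.integral_comp_sub_left (a := 0) (b := Real.pi / 2)
      (fun φ => Real.sin φ * G (Real.cos φ ^ 2)) (Real.pi / 2)
    simp only [Real.sin_pi_div_two_sub, Real.cos_pi_div_two_sub, sub_self, sub_zero] at this
    exact this.symm
  have h2 : ∫ φ in Real.pi / 2..Real.pi, Real.sin φ * G (Real.cos φ ^ 2)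
      = ∫ φ in (0 : ℝ)..Real.pi / 2, Real.sin φ * G (Real.cos φ ^ 2) := by
    have := intervalIntegral.integral_comp_sub_left (a := 0) (b := Real.pi / 2)
      (fun φ => Real.sin φ * G (Real.cos φ ^ 2)) Real.pi
    simp only [Real.sin_pi_sub, Real.cos_pi_sub, neg_sq, sub_zero, sub_half] at this
    exact this.symm
  have h3 : ∫ φ in Ioc 0 Real.pi, Real.sin φ * G (Real.cos φ ^ 2)
      = 2 * ∫ φ in (0 : ℝ)..Real.pi / 2, Real.cos φ * G (Real.sin φ ^ 2) := by
    rw [← intervalIntegral.integral_of_le hpi.le,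
      ← intervalIntegral.integral_add_adjacent_intervals (hint 0 (Real.pi / 2)) (hint _ _),
      h2, h1, two_mul]
  have h4 : ∫⁻ φ in Ioc 0 Real.pi, ENNReal.ofReal (Real.sin φ) * ENNReal.ofReal (G (Real.cos φ ^ 2))
      = ENNReal.ofReal (∫ φ in Ioc 0 Real.pi, Real.sin φ * G (Real.cos φ ^ 2)) := by
    have hnn : ∀ φ ∈ Ioc 0 Real.pi, 0 ≤ Real.sin φ := fun φ hφ =>
      Real.sin_nonneg_of_nonneg_of_le_pi hφ.1.le hφ.2
    rw [ofReal_integral_eq_lintegral_ofReal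
      ((intervalIntegrable_iff_integrableOn_Ioc_of_le hpi.le).1 (hint _ _))
      ((ae_restrict_iff' measurableSet_Ioc).2 (ae_of_all _ fun φ hφ =>
        mul_nonneg (hnn φ hφ) (hG0 _)))]
    refine setLIntegral_congr_fun measurableSet_Ioc fun φ hφ => ?_
    exact (ENNReal.ofReal_mul (hnn φ hφ)).symm
  rw [integral_eq_lintegral_of_nonneg_ae (ae_of_all _ fun p => hG0 _)
    (hG.comp hm).aestronglyMeasurable,
    lintegral_orbitIntensity hlam (g := fun s => ENNReal.ofReal (G s)) (by fun_prop) ha, h4, h3,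
    ENNReal.toReal_mul, ENNReal.toReal_ofReal (by positivity), ENNReal.toReal_ofReal]
  · ring
  · refine mul_nonneg zero_le_two (intervalIntegral.integral_nonneg (by positivity) fun φ hφ => ?_)
    exact mul_nonneg (Real.cos_nonneg_of_mem_Icc ⟨by linarith [hφ.1], hφ.2⟩) (hG0 _)

theorem SatelliteNetwork.IsCox.void_probability_sphericalCap {Ω : Type*} [MeasurableSpace Ω]
    {S : SatelliteNetwork Ω} {P : Measure Ω} [IsProbabilityMeasure P] {lam mu rs φhat : ℝ}
    (hS : S.IsCox P lam mu rs) (hlam : 0 ≤ lam) (hmu : 0 ≤ mu) (hrs : 0 < rs) (h0 : 0 ≤ φhat)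
    (h1 : φhat ≤ Real.pi / 2) {a : Space3} (ha : ‖a‖ = 1) :
    P.real {ω | S.satPoints rs ω (sphericalCap rs (Real.cos φhat) a) = 0}
      = voidFormula lam mu φhat := by
  have hpi := Real.pi_pos
  have hc : 0 ≤ Real.cos φhat := Real.cos_nonneg_of_mem_Icc ⟨by linarith, h1⟩
  rw [hS.void_probability hmu hrs (measurableSet_sphericalCap _ _ _), voidFormula]
  set c := Real.cos φhat with hcdef
  set G : ℝ → ℝ := fun s => 1 - Real.exp (-(mu / Real.pi * Real.arcsin √(1 - c ^ 2 / (1 - s))))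
    with hGdef
  have hG : Measurable G := by
    have := Real.continuous_arcsin.measurable
    fun_prop
  have hasin : ∀ s, 0 ≤ mu / Real.pi * Real.arcsin √(1 - c ^ 2 / (1 - s)) := fun s =>
    mul_nonneg (by positivity) (Real.arcsin_nonneg.2 (Real.sqrt_nonneg _))
  have hG0 : ∀ s, 0 ≤ G s := fun s =>
    sub_nonneg.2 (Real.exp_le_one_iff.2 (neg_nonpos.2 (hasin s)))
  have hG1 : ∀ s, G s ≤ 1 := fun s => sub_le_self _ (Real.exp_nonneg _)
  have hq : ∫ p, (1 - Real.exp (-(meanCount mu rs (sphericalCap rs c a) p).toReal))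
      ∂(orbitIntensity lam)
      = ∫ p, G (inner ℝ a (orbitNormal p.1 p.2) ^ 2) ∂(orbitIntensity lam) := by
    refine integral_congr_ae ?_
    filter_upwards [ae_inner_orbitNormal_sq_ne_one hlam ha] with p hp
    rw [meanCount_sphericalCap hmu hrs hc ha hp]
  have hint : ∀ x y : ℝ, IntervalIntegrable (fun φ => Real.cos φ * G (Real.sin φ ^ 2)) volume x y := by
    intro x y
    refine intervalIntegrable_const (c := (1 : ℝ)) |>.mono_fun
      (Measurable.aestronglyMeasurable (by fun_prop)) (ae_of_all _ fun φ => ?_)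
    simp only [norm_mul]
    rw [Real.norm_eq_abs, Real.norm_of_nonneg (hG0 _), norm_one]
    exact mul_le_one₀ (Real.abs_cos_le_one φ) (hG0 _) (hG1 _)
  -- Here `φ` is the angle between the cap axis and the orbital plane; beyond `φhat` the orbit
  -- misses the cap, and the square root of a nonpositive number is `0`.
  have htail : ∫ φ in φhat..Real.pi / 2, Real.cos φ * G (Real.sin φ ^ 2) = 0 := by
    rw [intervalIntegral.integral_of_le h1]
    refine setIntegral_eq_zero_of_forall_eq_zero fun φ hφ => ?_
    rcases eq_or_ne (Real.cos φ) 0 with h | h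
    · rw [h, zero_mul]
    have hlt : Real.cos φ < c :=
      Real.cos_lt_cos_of_nonneg_of_le_pi h0 (by linarith [hφ.2]) hφ.1
    have hcos : 0 < Real.cos φ :=
      (Real.cos_nonneg_of_mem_Icc ⟨by linarith [hφ.1], hφ.2⟩).lt_of_ne' h
    have hle : 1 - c ^ 2 / (1 - Real.sin φ ^ 2) ≤ 0 := by
      rw [← Real.cos_sq', sub_nonpos, one_le_div (by positivity)]
      gcongr
    simp [hGdef, Real.sqrt_eq_zero_of_nonpos hle]
  rw [hq, integral_orbitIntensity hlam hG hG0 hG1 ha,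
    ← intervalIntegral.integral_add_adjacent_intervals (hint 0 φhat) (hint _ _), htail, add_zero,
    neg_mul]
  congr 3
  refine intervalIntegral.integral_congr fun φ _ => ?_
  simp only [hGdef, ← Real.cos_sq', neg_mul, one_div, inv_pow, div_eq_mul_inv (c ^ 2)]

/-! ### The connectivity probability -/

theorem visibleCap_platform_eq_sphericalCap {re ra rs : ℝ} (hre : 0 < re) (hra : re < ra)
    (hrs : ra < rs) (z α : ℝ) :
    visibleCap re rs (platform re ra z α) = sphericalCap rs (Real.cos (capAngle re ra rs z))
      ((platformRadius re ra z)⁻¹ • platform re ra z α) := by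
  have hR : 0 < platformRadius re ra z := hre.trans (lt_platformRadius hre hra z)
  rw [visibleCap_platform hre hra hrs]
  ext x
  simp only [sphericalCap, mem_ofPred_eq, real_inner_smul_left, inv_mul_eq_div, le_div_iff₀ hR]
  ring_nf

theorem measurable_platform (re ra : ℝ) :
    Measurable fun y : ℝ × ℝ => platform re ra y.1 y.2 := by
  refine Measurable.const_add ((PiLp.continuous_toLp 2 _).measurable.comp
    (measurable_pi_lambda _ fun i => ?_)) _
  fin_cases i <;> simp [Real.tan_eq_sin_div_cos] <;> fun_prop

theorem measurableSet_visibleCap_platform {re ra rs : ℝ} (hre : 0 < re) (hra : re < ra)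
    (hrs : ra < rs) :
    MeasurableSet {q : (ℝ × ℝ) × Space3 | q.2 ∈ visibleCap re rs (platform re ra q.1.1 q.1.2)} := by
  have hR : Measurable (platformRadius re ra) := by
    unfold platformRadius
    simp_rw [Real.tan_eq_sin_div_cos]
    fun_prop
  have hc : Measurable (capAngle re ra rs) := by
    have := Real.continuous_arccos.measurable
    unfold capAngle
    fun_prop
  simp_rw [visibleCap_platform hre hra hrs]
  have h1 : MeasurableSet {q : (ℝ × ℝ) × Space3 | ‖q.2‖ = rs} :=
    measurableSet_eq_fun measurable_snd.norm measurable_const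
  refine h1.inter (measurableSet_le
    (f := fun q : (ℝ × ℝ) × Space3 =>
      platformRadius re ra q.1.1 * rs * Real.cos (capAngle re ra rs q.1.1))
    (by fun_prop) (Measurable.inner ((measurable_platform re ra).comp measurable_fst) measurable_snd))

/-- The kernel that normalizes a finite measure to total mass one. -/
noncomputable def normalizeKernel (X : Type*) [MeasurableSpace X] : Kernel (Measure X) X where
  toFun m := (m univ)⁻¹ • m
  measurable' := by
    refine Measure.measurable_of_measurable_coe _ fun B hB => ?_
    simp only [Measure.smul_apply, smul_eq_mul]
    exact (Measure.measurable_coe .univ).inv.mul (Measure.measurable_coe hB)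

theorem normalizeKernel_apply {X : Type*} [MeasurableSpace X] (m : Measure X) (B : Set X) :
    normalizeKernel X m B = (m univ)⁻¹ * m B := rfl

instance isFiniteKernel_normalizeKernel (X : Type*) [MeasurableSpace X] :
    IsFiniteKernel (normalizeKernel X) :=
  ⟨⟨1, ENNReal.one_lt_top, fun m => by
    rw [normalizeKernel_apply]
    exact ENNReal.inv_mul_le_one _⟩⟩

/-- Joint measurability in the set and the measure follows from that of sections under a finite
kernel. Normalizing provides finiteness and does not alter the null sets of a measure of finite
mass. -/
theorem measurableSet_normalizeKernel_eq_zero {X Y : Type*} [MeasurableSpace X] [MeasurableSpace Y]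
    {D : Set (Y × X)} (hD : MeasurableSet D) :
    MeasurableSet {q : Y × Measure X | normalizeKernel X q.2 {x | (q.1, x) ∈ D} = 0} := by
  have hmap : Measurable fun r : (Y × Measure X) × X => (r.1.1, r.2) := by fun_prop
  have := Kernel.measurable_kernel_prodMk_left
    (κ := (normalizeKernel X).comap (Prod.snd : Y × Measure X → Measure X) measurable_snd) (hmap hD)
  exact this (measurableSet_singleton 0)

namespace SatelliteNetwork

variable {Ω : Type*} [MeasurableSpace Ω] (S : SatelliteNetwork Ω)

theorem satPoints_univ_ne_top (rs : ℝ) (ω : Ω) : S.satPoints rs ω univ ≠ ⊤ := by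
  simp [satPoints, satOnOrbit, Finset.sum_apply]

theorem normalizeKernel_satPoints_eq_zero_iff {rs : ℝ} {ω : Ω} {C : Set Space3} :
    normalizeKernel Space3 (S.satPoints rs ω) C = 0 ↔ S.satPoints rs ω C = 0 := by
  rw [normalizeKernel_apply, mul_eq_zero, ENNReal.inv_eq_zero]
  exact or_iff_right (S.satPoints_univ_ne_top rs ω)

theorem satPoints_ne_zero_iff {rs : ℝ} {ω : Ω} {C : Set Space3} (hC : MeasurableSet C) :
    S.satPoints rs ω C ≠ 0
      ↔ ∃ i < S.numOrbits ω, ∃ j < S.numSat i ω, S.satellite rs i j ω ∈ C := by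
  rw [Ne, satPoints_apply_eq_zero_iff]
  simp [satOnOrbit, Finset.sum_apply, Measure.dirac_apply' _ hC]

end SatelliteNetwork

theorem proposition1 {Ω : Type*} [MeasurableSpace Ω] (P : Measure Ω) [IsProbabilityMeasure P]
    (re ra rs lam mu : ℝ) (hre : 0 < re) (hra : re < ra) (hrs : ra < rs)
    (hlam : 0 ≤ lam) (hmu : 0 ≤ mu)
    (S : SatelliteNetwork Ω) (hS : S.IsCox P lam mu rs)
    (Z α : Ω → ℝ) (hZ : Measurable Z) (hα : Measurable α)
    (hZrange : ∀ᵐ ω ∂P, 0 ≤ Z ω ∧ Z ω < Real.pi / 2)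
    (hindep : IndepFun (fun ω => (Z ω, α ω)) (S.satPoints rs) P)
    (hcap : ∀ᵐ ω ∂P, capAngle re ra rs (Z ω) ≤ Real.pi / 2) :
    MeasurableSet (connectivityEvent S re ra rs Z α) ∧
      Integrable (fun ω => voidFormula lam mu (capAngle re ra rs (Z ω))) P ∧
      P.real (connectivityEvent S re ra rs Z α)
        = 1 - ∫ ω, voidFormula lam mu (capAngle re ra rs (Z ω)) ∂P := by
  have hrs0 : 0 < rs := hre.trans (hra.trans hrs)
  set Y : Ω → ℝ × ℝ := fun ω => (Z ω, α ω)
  have hY : Measurable Y := hZ.prodMk hα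
  set cap : ℝ × ℝ → Set Space3 := fun y => visibleCap re rs (platform re ra y.1 y.2) with hcapdef
  have hcapm : ∀ y, MeasurableSet (cap y) := fun y => by
    rw [hcapdef]
    simp only [visibleCap_platform_eq_sphericalCap hre hra hrs]
    exact measurableSet_sphericalCap _ _ _
  set E : Set ((ℝ × ℝ) × Measure Space3) := {q | normalizeKernel Space3 q.2 (cap q.1) = 0}
  have hE : MeasurableSet E :=
    measurableSet_normalizeKernel_eq_zero (measurableSet_visibleCap_platform hre hra hrs)
  have hM := S.measurable_satPoints rs
  have hYM : Measurable fun ω => (Y ω, S.satPoints rs ω) := hY.prodMk hM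
  have hcompl : connectivityEvent S re ra rs Z α = ((fun ω => (Y ω, S.satPoints rs ω)) ⁻¹' E)ᶜ := by
    ext ω
    rw [mem_compl_iff, mem_preimage]
    exact (S.satPoints_ne_zero_iff (hcapm (Y ω))).symm.trans
      (not_congr S.normalizeKernel_satPoints_eq_zero_iff.symm)
  have hEvent := hYM hE
  -- The void probability for a platform frozen at `y`; by isotropy the azimuth drops out of its
  -- value.
  set v : ℝ × ℝ → ENNReal := fun y => P.map (S.satPoints rs) (Prod.mk y ⁻¹' E)
  have hv : Measurable v := by
    have : IsProbabilityMeasure (P.map (S.satPoints rs)) :=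
      Measure.isProbabilityMeasure_map hM.aemeasurable
    exact measurable_measure_prodMk_left hE
  have hvtop : ∀ y, v y < ⊤ := fun y => by
    have : IsProbabilityMeasure (P.map (S.satPoints rs)) :=
      Measure.isProbabilityMeasure_map hM.aemeasurable
    exact measure_lt_top _ _
  have hvoid : (fun ω => (v (Y ω)).toReal)
      =ᵐ[P] fun ω => voidFormula lam mu (capAngle re ra rs (Z ω)) := by
    filter_upwards [hcap] with ω hω
    have hR : 0 < platformRadius re ra (Z ω) := hre.trans (lt_platformRadius hre hra _)
    have hunit : ‖(platformRadius re ra (Z ω))⁻¹ • platform re ra (Z ω) (α ω)‖ = 1 := by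
      rw [norm_smul, norm_platform, Real.norm_of_nonneg (by positivity), inv_mul_cancel₀ hR.ne']
    have h0 : 0 ≤ capAngle re ra rs (Z ω) :=
      add_nonneg (Real.arccos_nonneg _) (Real.arccos_nonneg _)
    rw [← hS.void_probability_sphericalCap hlam hmu hrs0 h0 hω hunit,
      ← visibleCap_platform_eq_sphericalCap hre hra hrs]
    change (P.map (S.satPoints rs) (Prod.mk (Y ω) ⁻¹' E)).toReal = _
    rw [Measure.map_apply hM (measurable_prodMk_left hE)]
    congr 2
    ext ω'
    exact S.normalizeKernel_satPoints_eq_zero_iff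
  have hP : P ((fun ω => (Y ω, S.satPoints rs ω)) ⁻¹' E) = ∫⁻ ω, v (Y ω) ∂P := by
    have : IsProbabilityMeasure (P.map (S.satPoints rs)) :=
      Measure.isProbabilityMeasure_map hM.aemeasurable
    -- Independence makes the joint law of platform and satellites a product, so Tonelli applies.
    rw [← Measure.map_apply hYM hE,
      (indepFun_iff_map_prod_eq_prod_map_map hY.aemeasurable hM.aemeasurable).1 hindep,
      Measure.prod_apply hE, lintegral_map hv hY]
  have hvY : Measurable fun ω => v (Y ω) := hv.comp hY
  refine ⟨hcompl ▸ hEvent.compl, ?_, ?_⟩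
  · refine Integrable.congr (integrable_toReal_of_lintegral_ne_top hvY.aemeasurable ?_) hvoid
    rw [← hP]
    exact measure_ne_top _ _
  · rw [hcompl, probReal_compl_eq_one_sub hEvent, ← integral_congr_ae hvoid,
      integral_toReal hvY.aemeasurable (ae_of_all _ fun ω => hvtop _), ← hP]
    rfl
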